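/- **Theorem.** An $[n,k,d]_q$-code is a $k$-dimensional linear subspace $C\subseteq\mathbb{F}_q^n$ in which any two distinct codewords have Hamming distance at least $d$. The code $C$ has locality $r$ if for every coordinate $i\in\{1,\dots,n\}$ there is a set $S_i\subseteq\{1,\dots,n\}\setminus\{i\}$ with $|S_i|\le r$ such that any two codewords of $C$ that agree in all coordinates from $S_i$ also agree in coordinate $i$. Let $n_q(k,d,r)$ denote the smallest $n$ for which there exists an $[n,k,d]_q$-code with locality $r$. Then for every integer $t\ge 0$ we have $$ \begin{aligned} n_2(5,9+16t,2)&=20+31t, & n_2(5,10+16t,2)&=21+31t,\\ n_2(5,11+16t,2)&=23+31t, & n_2(5,12+16t,2)&=24+31t,\\ n_2(5,13+16t,2)&=27+31t, & n_2(5,14+16t,2)&=28+31t,\\ n_2(5,15+16t,2)&=30+31t, & n_2(5,16+16t,2)&=31+31t,\\ n_2(5,17+16t,2)&=36+31t, & n_2(5,18+16t,2)&=37+31t,\\ n_2(5,19+16t,2)&=39+31t, & n_2(5,20+16t,2)&=40+31t,\\ n_2(5,21+16t,2)&=43+31t, & n_2(5,22+16t,2)&=44+31t,\\ n_2(5,23+16t,2)&=46+31t,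 & n_2(5,24+16t,2)&=47+31t. \end{aligned} $$ Moreover, $$ n_2(5,1,2)=n_2(5,2,2)=8,\quad n_2(5,3,2)=10,\quad n_2(5,4,2)=11,\quad n_2(5,5,2)=13,\quad n_2(5,6,2)=14,\quad n_2(5,7,2)=16,\quad n_2(5,8,2)=17. $$ -/

import Mathlib

/-- A code `C ⊆ F ^ n` has locality `r`: each coordinate `i` has a recovery set `S` of at most `r`
other coordinates, such that any two codewords that agree on `S` agree at `i`. -/
def HasLocality {F : Type*} {n : ℕ} (C : Set (Fin n → F)) (r : ℕ) : Prop :=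
  ∀ i : Fin n, ∃ S : Finset (Fin n), i ∉ S ∧ S.card ≤ r ∧
    ∀ x ∈ C, ∀ y ∈ C, (∀ j ∈ S, x j = y j) → x i = y i

/-- `C` is an `[n, k, d]`-code over `F`: a `k`-dimensional subspace of `F ^ n` in which any two
distinct codewords have Hamming distance at least `d`. -/
def IsLinearCode {F : Type*} [Field F] [DecidableEq F] {n : ℕ}
    (C : Submodule F (Fin n → F)) (k d : ℕ) : Prop :=
  Module.finrank F C = k ∧ ∀ x ∈ C, ∀ y ∈ C, x ≠ y → d ≤ hammingDist x y

/-- The lengths `n` for which some `[n, k, d]`-code over `F` has locality `r`. -/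
def lrcLengths (F : Type*) [Field F] [DecidableEq F] (k d r : ℕ) : Set ℕ :=
  {n | ∃ C : Submodule F (Fin n → F), IsLinearCode C k d ∧ HasLocality (C : Set (Fin n → F)) r}

/-- The number `n_q(k, d, r)`, where `q` is the order of `F`: the smallest length of an
`[n, k, d]`-code over `F` with locality `r`, and `∞` if there is no such code. -/
noncomputable def minLRCLength (F : Type*) [Field F] [DecidableEq F] (k d r : ℕ) : ℕ∞ :=
  ⨅ n ∈ lrcLengths F k d r, (n : ℕ∞)

/-- A finite value `m` of `n_q(k, d, r)` is an attained minimum. -/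
theorem minLRCLength_eq_coe_iff (F : Type*) [Field F] [DecidableEq F] (k d r m : ℕ) :
    minLRCLength F k d r = (m : ℕ∞) ↔ IsLeast (lrcLengths F k d r) m := by
  constructor
  · intro h
    have hne : (lrcLengths F k d r).Nonempty := by
      by_contra hne
      rw [Set.not_nonempty_iff_eq_empty] at hne
      simp [minLRCLength, hne] at h
    have hs : IsLeast (lrcLengths F k d r) (sInf (lrcLengths F k d r)) :=
      ⟨Nat.sInf_mem hne, fun n hn => Nat.sInf_le hn⟩
    have h2 : minLRCLength F k d r = ((sInf (lrcLengths F k d r) : ℕ) : ℕ∞) :=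
      le_antisymm (iInf₂_le _ hs.1) (le_iInf₂ fun n hn => by exact_mod_cast hs.2 hn)
    have h3 : m = sInf (lrcLengths F k d r) := by
      rw [h] at h2
      exact_mod_cast h2
    rw [h3]
    exact hs
  · intro h
    exact le_antisymm (iInf₂_le _ h.1) (le_iInf₂ fun n hn => by exact_mod_cast h.2 hn)

/-!
A binary code of dimension `5` and length `n` is a multiset of `n` vectors of `𝔽₂⁵`, the columns of
a generator matrix; minimum distance at least `d` says that every hyperplane contains at most
`n - d` of them, and locality `2` says that every column is zero, is repeated, or is the sum of two
other columns.

*Lower bounds.* The Griesmer bound `n ≥ ∑_{i < k} ⌈d / 2 ^ i⌉` is proved by passing to residual codes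
(`card_add_griesmerBound_le`). It settles all distances `d ≥ 9` without using the locality. For
smaller distances it is applied to shortened codes: requiring a codeword to vanish on a recovery set
of at most two coordinates makes a third coordinate vanish for free, so that two dimensions buy three
coordinates (`HasShortening.add_three`).
* For `d ≥ 5`, one such step leaves a code of dimension `3` and length `n - 3`.
* For `d ≤ 2`, three steps exhaust the five dimensions, and the last one spends a single dimension on
  two coordinates, which gives `n ≥ 3 + 3 + 2`.
* For `d = 3` and `d = 4`, two steps leave a code of dimension `1` and length `n - 6`, which is one
  coordinate short of what is needed. Here the geometry helps: unless five columns lie in a subspace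
  of dimension three, the columns form pairwise skew lines of `PG(4, 2)`. The hyperplane spanned by
  two of these lines meets a third one, and hence contains seven columns
  (`hasShortening_two_five_or_one_seven`).

*Codes.* For `9 ≤ d ≤ 24`, remove points, lines, planes and a solid from one or two copies of
`PG(4, 2)`; for `d ≤ 8` the columns are listed. The distance and the locality of such a list of
columns are verified by evaluation (`mem_lrcLengths_of_isLRCCertificate`). Appending `t` copies of the
simplex code adds `31 t` to the length and `16 t` to the distance and keeps the locality
(`add_mul_mem_lrcLengths`), and the Griesmer bound grows by the same `31 t`.
-/

/-! ### The Griesmer bound for binary codes -/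

/-- The Griesmer bound `∑_{i < k} ⌈d / 2 ^ i⌉`, in the recursive form that its proof produces. -/
def griesmerBound : ℕ → ℕ → ℕ
  | 0, _ => 0
  | k + 1, d => d + griesmerBound k ((d + 1) / 2)

theorem griesmerBound_mono_right (k : ℕ) : Monotone (griesmerBound k) := by
  induction k with
  | zero => exact fun _ _ _ => le_rfl
  | succ k ih =>
    intro a b h
    exact Nat.add_le_add h (ih (Nat.div_le_div_right (by omega)))

/-- The linear map that replaces the coordinates in the support of `x` by zero. On a code containing
`x` its image is the residual code with respect to `x`, kept in the same ambient space. -/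
def eraseSupport {n : ℕ} (x : Fin n → ZMod 2) : (Fin n → ZMod 2) →ₗ[ZMod 2] (Fin n → ZMod 2) where
  toFun y i := if x i = 0 then y i else 0
  map_add' y z := by
    ext i
    by_cases h : x i = 0 <;> simp [h]
  map_smul' a y := by
    ext i
    by_cases h : x i = 0 <;> simp [h]

theorem eraseSupport_apply {n : ℕ} (x y : Fin n → ZMod 2) (i : Fin n) :
    eraseSupport x y i = if x i = 0 then y i else 0 := rfl

/-- On the support of `x`, exactly one of `y` and `x + y` is nonzero; off it, they agree. -/
theorem hammingNorm_add_hammingNorm_add {n : ℕ} (x y : Fin n → ZMod 2) :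
    hammingNorm y + hammingNorm (x + y) =
      2 * hammingNorm (eraseSupport x y) + hammingNorm x := by
  have key : ∀ a b : ZMod 2, ((if b ≠ 0 then 1 else 0) + (if a + b ≠ 0 then 1 else 0) : ℕ) =
      2 * (if (if a = 0 then b else 0) ≠ 0 then 1 else 0) + (if a ≠ 0 then 1 else 0) := by
    decide
  simp only [hammingNorm, Finset.card_filter, Finset.mul_sum, ← Finset.sum_add_distrib]
  exact Finset.sum_congr rfl fun i _ => key (x i) (y i)

/-- The binary Griesmer bound for a code that vanishes on the coordinates in `T`. -/
theorem card_add_griesmerBound_le {n : ℕ} (k : ℕ) : ∀ (d : ℕ)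
    (D : Submodule (ZMod 2) (Fin n → ZMod 2)) (T : Finset (Fin n)),
    (∀ x ∈ D, ∀ i ∈ T, x i = 0) → k ≤ Module.finrank (ZMod 2) D →
    (∀ x ∈ D, x ≠ 0 → d ≤ hammingNorm x) → T.card + griesmerBound k d ≤ n := by
  induction k with
  | zero =>
    intro d D T _ _ _
    simpa [griesmerBound] using T.card_le_univ
  | succ k ih =>
    intro d D T hT hk hd
    -- a nonzero codeword `x` of least weight
    have hne : ∃ w, ∃ x ∈ D, x ≠ 0 ∧ hammingNorm x = w := by
      have hD : D ≠ ⊥ := by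
        rintro rfl
        simp at hk
      obtain ⟨x, hx, hx0⟩ := Submodule.exists_mem_ne_zero_of_ne_bot hD
      exact ⟨_, x, hx, hx0, rfl⟩
    classical
    obtain ⟨x, hx, hx0, hxw⟩ := Nat.find_spec hne
    have hmin : ∀ y ∈ D, y ≠ 0 → hammingNorm x ≤ hammingNorm y := fun y hy hy0 => by
      rw [hxw]
      exact Nat.find_min' hne ⟨y, hy, hy0, rfl⟩
    have hpos : 0 < hammingNorm x := hammingNorm_pos_iff.mpr hx0
    have hself : ∀ y : Fin n → ZMod 2, x + y = 0 → y = x := fun y h => by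
      rw [← neg_eq_of_add_eq_zero_right h]
      ext i
      exact ZMod.neg_eq_self_mod_two _
    set π := eraseSupport x with hπ
    -- only multiples of `x` are supported in the support of `x`
    have hker : ∀ y ∈ D, π y = 0 → y = 0 ∨ y = x := by
      intro y hy h
      by_contra! hyx
      have h1 := hmin y hy hyx.1
      have h2 := hmin (x + y) (D.add_mem hx hy) fun h => hyx.2 (hself y h)
      have h3 := hammingNorm_add_hammingNorm_add x y
      rw [← hπ, h, hammingNorm_zero] at h3
      omega
    have hrank : k ≤ Module.finrank (ZMod 2) (D.map π) := by
      have h1 := LinearMap.finrank_range_add_finrank_ker (π.domRestrict D)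
      have h2 : Module.finrank (ZMod 2) (LinearMap.ker (π.domRestrict D)) ≤ 1 := by
        refine finrank_le_one (⟨⟨x, hx⟩, ?_⟩) ?_
        · ext i
          by_cases h : x i = 0 <;> simp [hπ, eraseSupport_apply, h]
        · rintro ⟨⟨y, hy⟩, hy'⟩
          rcases hker y hy hy' with h | h
          · exact ⟨0, by ext; simp [h]⟩
          · exact ⟨1, by ext; simp [h]⟩
      rw [LinearMap.range_domRestrict] at h1
      omega
    have hsupp : Disjoint T (Finset.univ.filter fun i => x i ≠ 0) := by
      rw [Finset.disjoint_left]
      intro i hi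
      simp [hT x hx i hi]
    have := ih ((hammingNorm x + 1) / 2) (D.map π) (T ∪ Finset.univ.filter fun i => x i ≠ 0)
      (by
        rintro _ ⟨y, hy, rfl⟩ i hi
        rw [hπ, eraseSupport_apply]
        split_ifs with h
        · have : i ∈ T := by simpa [h] using hi
          exact hT y hy i this
        · rfl)
      hrank
      (by
        rintro _ ⟨y, hy, rfl⟩ h
        have h3 := hammingNorm_add_hammingNorm_add x y
        rw [← hπ] at h3
        have h1 : hammingNorm x ≤ hammingNorm y := by
          refine hmin y hy ?_
          rintro rfl
          simp at h
        have h2 : hammingNorm x ≤ hammingNorm (x + y) := by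
          refine hmin (x + y) (D.add_mem hx hy) fun h0 => h ?_
          rw [hself y h0]
          ext i
          by_cases h : x i = 0 <;> simp [hπ, eraseSupport_apply, h]
        omega)
    rw [Finset.card_union_of_disjoint hsupp] at this
    have hw : d ≤ hammingNorm x := hd x hx hx0
    have hg := griesmerBound_mono_right k
      (show (d + 1) / 2 ≤ (hammingNorm x + 1) / 2 from Nat.div_le_div_right (by omega))
    have hc : (Finset.univ.filter fun i => x i ≠ 0).card = hammingNorm x := rfl
    rw [griesmerBound]
    omega

/-! ### Shortening a code along recovery sets -/

/-- The subcode of the codewords of `C` that vanish on the coordinates in `T`. -/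
def shorten {n : ℕ} (C : Submodule (ZMod 2) (Fin n → ZMod 2)) (T : Finset (Fin n)) :
    Submodule (ZMod 2) (Fin n → ZMod 2) where
  carrier := {x | x ∈ C ∧ ∀ i ∈ T, x i = 0}
  add_mem' hx hy := ⟨C.add_mem hx.1 hy.1, fun i hi => by simp [hx.2 i hi, hy.2 i hi]⟩
  zero_mem' := ⟨C.zero_mem, fun _ _ => rfl⟩
  smul_mem' a _ hx := ⟨C.smul_mem a hx.1, fun i hi => by simp [hx.2 i hi]⟩

/-- `S` is a recovery set for the coordinate `i` of `C`. -/
def Recovers {n : ℕ} (C : Submodule (ZMod 2) (Fin n → ZMod 2)) (S : Finset (Fin n))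
    (i : Fin n) : Prop :=
  i ∉ S ∧ ∀ x ∈ C, ∀ y ∈ C, (∀ j ∈ S, x j = y j) → x i = y i

/-- `C` has a subcode of dimension at least `m` that vanishes on at least `s` coordinates. In terms
of the columns of a generator matrix of a code of dimension `k`: at least `s` columns lie in a
subspace of dimension at most `k - m`. -/
def HasShortening {n : ℕ} (C : Submodule (ZMod 2) (Fin n → ZMod 2)) (m s : ℕ) : Prop :=
  ∃ T : Finset (Fin n), s ≤ T.card ∧ m ≤ Module.finrank (ZMod 2) (shorten C T)

section Shortening

variable {n : ℕ} {C : Submodule (ZMod 2) (Fin n → ZMod 2)}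

theorem mem_shorten {T : Finset (Fin n)} {x : Fin n → ZMod 2} :
    x ∈ shorten C T ↔ x ∈ C ∧ ∀ i ∈ T, x i = 0 := Iff.rfl

theorem shorten_empty : shorten C ∅ = C := by
  ext x
  simp [mem_shorten]

theorem Recovers.eq_zero {S : Finset (Fin n)} {i : Fin n} (h : Recovers C S i)
    {x : Fin n → ZMod 2} (hx : x ∈ C) (hS : ∀ j ∈ S, x j = 0) : x i = 0 :=
  h.2 x hx 0 C.zero_mem hS

theorem finrank_shorten_le_insert (T : Finset (Fin n)) (i : Fin n) :
    Module.finrank (ZMod 2) (shorten C T) ≤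
      Module.finrank (ZMod 2) (shorten C (insert i T)) + 1 := by
  let f : shorten C T →ₗ[ZMod 2] ZMod 2 := (LinearMap.proj i).domRestrict (shorten C T)
  have h1 := LinearMap.finrank_range_add_finrank_ker f
  have h2 : Module.finrank (ZMod 2) (LinearMap.range f) ≤ 1 := by
    simpa using Submodule.finrank_le (LinearMap.range f)
  have h3 : (LinearMap.ker f).map (shorten C T).subtype ≤ shorten C (insert i T) := by
    rintro _ ⟨⟨x, hx⟩, hx', rfl⟩
    refine ⟨hx.1, fun j hj => ?_⟩
    rcases Finset.mem_insert.mp hj with rfl | hj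
    · exact hx'
    · exact hx.2 j hj
  have h4 := Submodule.finrank_mono h3
  rw [Submodule.finrank_map_subtype_eq] at h4
  omega

theorem finrank_shorten_le_union (T U : Finset (Fin n)) :
    Module.finrank (ZMod 2) (shorten C T) ≤
      Module.finrank (ZMod 2) (shorten C (T ∪ U)) + U.card := by
  induction U using Finset.induction_on with
  | empty => rw [Finset.union_empty, Finset.card_empty, add_zero]
  | insert i U hi ih =>
    have := finrank_shorten_le_insert (C := C) (T ∪ U) i
    rw [Finset.card_insert_of_notMem hi, Finset.union_insert]
    omega

/-- Adding a coordinate together with a recovery set to `T` enlarges `T` by one more than it costs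
in dimension. -/
theorem Recovers.finrank_shorten_le {S : Finset (Fin n)} {i : Fin n} (h : Recovers C S i)
    (T : Finset (Fin n)) :
    Module.finrank (ZMod 2) (shorten C T) ≤
      Module.finrank (ZMod 2) (shorten C (insert i (T ∪ S))) + (S \ T).card := by
  have h1 := finrank_shorten_le_union (C := C) T (S \ T)
  rw [Finset.union_sdiff_self_eq_union] at h1
  have h2 : shorten C (T ∪ S) ≤ shorten C (insert i (T ∪ S)) := by
    rintro x ⟨hx, hx0⟩
    refine ⟨hx, fun j hj => ?_⟩
    rcases Finset.mem_insert.mp hj with rfl | hj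
    · exact h.eq_zero hx fun j hj => hx0 j (Finset.mem_union_right _ hj)
    · exact hx0 j hj
  have h3 := Submodule.finrank_mono h2
  omega

theorem Recovers.card_insert_union {S T : Finset (Fin n)} {i : Fin n} (h : Recovers C S i)
    (hi : i ∉ T) : (insert i (T ∪ S)).card = T.card + (S \ T).card + 1 := by
  rw [Finset.card_insert_of_notMem (by simp [hi, h.1]), ← Finset.union_sdiff_self_eq_union,
    Finset.card_union_of_disjoint Finset.disjoint_sdiff]

theorem exists_mem_shorten_apply_ne_zero {T : Finset (Fin n)}
    (h : 0 < Module.finrank (ZMod 2) (shorten C T)) :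
    ∃ x ∈ shorten C T, ∃ i, i ∉ T ∧ x i ≠ 0 := by
  have hne : shorten C T ≠ ⊥ := by
    intro h0
    rw [h0, finrank_bot] at h
    exact h.false
  obtain ⟨x, hx, hx0⟩ := Submodule.exists_mem_ne_zero_of_ne_bot hne
  obtain ⟨i, hi⟩ := Function.ne_iff.mp hx0
  exact ⟨x, hx, i, fun hiT => hi (hx.2 i hiT), hi⟩

theorem HasShortening.griesmerBound_le {m s d : ℕ} (h : HasShortening C m s)
    (hd : ∀ x ∈ C, x ≠ 0 → d ≤ hammingNorm x) : s + griesmerBound m d ≤ n := by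
  obtain ⟨T, hs, hm⟩ := h
  have := card_add_griesmerBound_le m d (shorten C T) T (fun x hx => hx.2) hm
    fun x hx => hd x hx.1
  omega

theorem hasShortening_finrank_zero : HasShortening C (Module.finrank (ZMod 2) C) 0 :=
  ⟨∅, le_rfl, by rw [shorten_empty]⟩

theorem HasShortening.succ {m s : ℕ} (h : HasShortening C (m + 1) s) :
    HasShortening C m (s + 1) := by
  obtain ⟨T, hs, hm⟩ := h
  obtain ⟨x, hx, i, hi, -⟩ := exists_mem_shorten_apply_ne_zero (Nat.lt_of_lt_of_le m.succ_pos hm)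
  refine ⟨insert i T, ?_, ?_⟩
  · rw [Finset.card_insert_of_notMem hi]
    omega
  · have := finrank_shorten_le_insert (C := C) T i
    omega

/-- The shortening obtained from a coordinate outside `T` and a recovery set that contributes `j`
coordinates outside `T`. -/
theorem HasShortening.exists_of_hasLocality {m s r : ℕ} (h : HasShortening C (m + 1) s)
    (hr : HasLocality (C : Set (Fin n → ZMod 2)) r) :
    ∃ j ≤ r, HasShortening C (m + 1 - j) (s + j + 1) := by
  obtain ⟨T, hs, hm⟩ := h
  obtain ⟨x, hx, i, hi, -⟩ := exists_mem_shorten_apply_ne_zero (Nat.lt_of_lt_of_le m.succ_pos hm)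
  obtain ⟨S, hiS, hSr, hS⟩ := hr i
  have hrec : Recovers C S i := ⟨hiS, hS⟩
  refine ⟨(S \ T).card, (Finset.card_le_card Finset.sdiff_subset).trans hSr,
    insert i (T ∪ S), ?_, ?_⟩
  · rw [hrec.card_insert_union hi]
    omega
  · have := hrec.finrank_shorten_le T
    omega

theorem HasShortening.add_three {m s : ℕ} (h : HasShortening C (m + 2) s)
    (hr : HasLocality (C : Set (Fin n → ZMod 2)) 2) : HasShortening C m (s + 3) := by
  obtain ⟨j, hj, hj'⟩ := h.exists_of_hasLocality hr
  interval_cases j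
  · exact hj'.succ.succ
  · exact hj'.succ
  · exact hj'

theorem HasShortening.add_two {s : ℕ} (h : HasShortening C 1 s)
    (hr : HasLocality (C : Set (Fin n → ZMod 2)) 2) : HasShortening C 0 (s + 2) := by
  obtain ⟨j, hj, T, hs, hm⟩ := HasShortening.exists_of_hasLocality (m := 0) h hr
  interval_cases j
  · exact HasShortening.succ ⟨T, hs, hm⟩
  · exact ⟨T, hs, hm⟩
  · exact ⟨T, by omega, hm⟩

/-- For a recovery set `{j, k}` of `i` no proper subset of which recovers `i`, codewords satisfy
`x i = x j + x k`; so the three coordinates are not all equal to `1`. -/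
theorem Recovers.eq_zero_or_eq_zero {i j k : Fin n} (h : Recovers C {j, k} i)
    (hj : ¬ Recovers C {j} i) (hk : ¬ Recovers C {k} i) {x : Fin n → ZMod 2} (hx : x ∈ C)
    (hxi : x i ≠ 0) : x j = 0 ∨ x k = 0 := by
  have one : ∀ {a : ZMod 2}, a ≠ 0 → a = 1 := by decide
  have hi : i ≠ j ∧ i ≠ k := by simpa using h.1
  have key : ∀ l, i ≠ l → ¬ Recovers C {l} i → ∃ y ∈ C, y l = 0 ∧ y i = 1 := by
    intro l hil hl
    by_contra! hy
    refine hl ⟨by simpa using hil, fun u hu v hv huv => ?_⟩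
    by_contra huv'
    exact hy (u - v) (C.sub_mem hu hv) (by simpa [sub_eq_zero] using huv)
      (one (by simpa [sub_eq_zero] using huv'))
  obtain ⟨y, hy, hyj, hyi⟩ := key j hi.1 hj
  obtain ⟨z, hz, hzk, hzi⟩ := key k hi.2 hk
  have hyk : y k = 1 := one fun h0 => by
    simpa [hyi] using h.eq_zero hy (by simp [hyj, h0])
  have hzj : z j = 1 := one fun h0 => by
    simpa [hzi] using h.eq_zero hz (by simp [hzk, h0])
  by_contra! hne
  have h2 : (1 : ZMod 2) + 1 = 0 := by decide
  -- `x + y + z` vanishes at `j` and `k`, but not at `i`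
  have := h.eq_zero (C.add_mem (C.add_mem hx hy) hz) (by
    simp [hyj, hzk, hyk, hzj, one hne.1, one hne.2, h2])
  simp [hyi, hzi, one hxi, h2] at this

/-- In terms of the columns of a generator matrix: either five of them lie in a subspace of
dimension three, or they are partitioned into pairwise skew lines of the projective space
`PG(4, 2)`. In the latter case two lines span a hyperplane, which a third line has to meet; so seven
columns lie in a hyperplane. -/
theorem hasShortening_two_five_or_one_seven (hC : Module.finrank (ZMod 2) C = 5)
    (hr : HasLocality (C : Set (Fin n → ZMod 2)) 2) :
    HasShortening C 2 5 ∨ HasShortening C 1 7 := by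
  by_contra! hno
  obtain ⟨h25, h17⟩ := hno
  have h0 : Module.finrank (ZMod 2) (shorten C ∅) = 5 := by rw [shorten_empty, hC]
  have hcard : ∀ {S : Finset (Fin n)} {i}, Recovers C S i → 2 ≤ S.card := by
    intro S i hS
    by_contra! hlt
    have h1 := hS.finrank_shorten_le ∅
    have h2 := hS.card_insert_union (Finset.notMem_empty i)
    rw [Finset.sdiff_empty] at h1 h2
    rw [Finset.card_empty] at h2
    interval_cases hj : S.card
    · exact h25 (HasShortening.succ
        (HasShortening.add_three ⟨insert i (∅ ∪ S), by omega, by omega⟩ hr))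
    · exact h25 (HasShortening.add_three (s := 2) ⟨insert i (∅ ∪ S), by omega, by omega⟩ hr)
  -- the lines through two different coordinates are equal or disjoint
  have hdisj : ∀ {S S' : Finset (Fin n)} {i i'}, Recovers C S i → Recovers C S' i' →
      S.card ≤ 2 → S'.card ≤ 2 → i' ∉ insert i S → Disjoint S' (insert i S) := by
    intro S S' i i' hS hS' hc hc' hi'
    by_contra hnd
    have h1 := hS.finrank_shorten_le ∅
    have h2 := hS.card_insert_union (Finset.notMem_empty i)
    rw [Finset.empty_union, Finset.sdiff_empty] at h1 h2
    rw [Finset.card_empty] at h2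
    have h3 := hS'.finrank_shorten_le (insert i S)
    have h4 := hS'.card_insert_union hi'
    have h5 := hcard hS
    have h6 : (S' \ insert i S).card < S'.card := by
      obtain ⟨a, ha, ha'⟩ := Finset.not_disjoint_iff.mp hnd
      refine Finset.card_lt_card (Finset.ssubset_iff_subset_ne.mpr ⟨Finset.sdiff_subset, ?_⟩)
      rintro h
      rw [← h] at ha
      exact (Finset.mem_sdiff.mp ha).2 ha'
    have h7 : (S' \ insert i S).card ≤ 1 := by omega
    interval_cases hj : (S' \ insert i S).card
    · exact h25 (HasShortening.succ ⟨insert i' (insert i S ∪ S'), by omega, by omega⟩)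
    · exact h25 ⟨insert i' (insert i S ∪ S'), by omega, by omega⟩
  obtain ⟨-, -, i₁, -, -⟩ := exists_mem_shorten_apply_ne_zero (C := C) (T := ∅) (by omega)
  obtain ⟨S₁, hi₁, hc₁, hS₁⟩ := hr i₁
  have R₁ : Recovers C S₁ i₁ := ⟨hi₁, hS₁⟩
  have a₁ := R₁.finrank_shorten_le ∅
  have b₁ := R₁.card_insert_union (Finset.notMem_empty i₁)
  rw [Finset.empty_union, Finset.sdiff_empty] at a₁ b₁
  rw [Finset.card_empty] at b₁
  obtain ⟨-, -, i₂, hi₂, -⟩ := exists_mem_shorten_apply_ne_zero (C := C)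
    (T := insert i₁ S₁) (by omega)
  obtain ⟨S₂, hi₂', hc₂, hS₂⟩ := hr i₂
  have R₂ : Recovers C S₂ i₂ := ⟨hi₂', hS₂⟩
  have a₂ := R₂.finrank_shorten_le (insert i₁ S₁)
  have b₂ := R₂.card_insert_union hi₂
  have d₂ := hdisj R₁ R₂ hc₁ hc₂ hi₂
  rw [Finset.sdiff_eq_self_of_disjoint d₂] at a₂ b₂
  obtain ⟨x, hx, i₃, hi₃, hxi⟩ := exists_mem_shorten_apply_ne_zero (C := C)
    (T := insert i₂ (insert i₁ S₁ ∪ S₂)) (by omega)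
  obtain ⟨S₃, hi₃', hc₃, hS₃⟩ := hr i₃
  have R₃ : Recovers C S₃ i₃ := ⟨hi₃', hS₃⟩
  have d₃₁ := hdisj R₁ R₃ hc₁ hc₃ fun h => hi₃ (by
    simp only [Finset.mem_insert, Finset.mem_union] at h ⊢
    tauto)
  have d₃₂ := hdisj R₂ R₃ hc₂ hc₃ fun h => hi₃ (by
    simp only [Finset.mem_insert, Finset.mem_union] at h ⊢
    tauto)
  obtain ⟨j, k, hjk, rfl⟩ := Finset.card_eq_two.mp (le_antisymm hc₃ (hcard R₃))
  have hsingle : ∀ l, ¬ Recovers C {l} i₃ := fun l hl => by simpa using hcard hl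
  have c₁ := hcard R₁
  have c₂ := hcard R₂
  -- the codeword `x` vanishes on the first two lines and at a point `l` of the third
  obtain ⟨l, hl, hxl⟩ : ∃ l ∈ ({j, k} : Finset (Fin n)), x l = 0 := by
    rcases R₃.eq_zero_or_eq_zero (hsingle j) (hsingle k) hx.1 hxi with h | h
    · exact ⟨j, by simp, h⟩
    · exact ⟨k, by simp, h⟩
  have hl' : l ∉ insert i₂ (insert i₁ S₁ ∪ S₂) := by
    have h1 := Finset.disjoint_left.mp d₃₁ hl
    have h2 := Finset.disjoint_left.mp d₃₂ hl
    simp only [Finset.mem_insert, Finset.mem_union] at h1 h2 ⊢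
    tauto
  refine h17 ⟨insert l (insert i₂ (insert i₁ S₁ ∪ S₂)), ?_, ?_⟩
  · rw [Finset.card_insert_of_notMem hl']
    omega
  · have hx' : x ∈ shorten C (insert l (insert i₂ (insert i₁ S₁ ∪ S₂))) := by
      refine ⟨hx.1, fun j hj => ?_⟩
      rcases Finset.mem_insert.mp hj with rfl | hj
      · exact hxl
      · exact hx.2 j hj
    refine Submodule.one_le_finrank_iff.mpr ?_
    rintro h
    rw [h, Submodule.mem_bot] at hx'
    exact hxi (by rw [hx']; rfl)

end Shortening

/-! ### Lower bounds for the length -/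

theorem exists_code_of_mem_lrcLengths {n k d r : ℕ} (h : n ∈ lrcLengths (ZMod 2) k d r) :
    ∃ C : Submodule (ZMod 2) (Fin n → ZMod 2), Module.finrank (ZMod 2) C = k ∧
      HasLocality (C : Set (Fin n → ZMod 2)) r ∧ HasShortening C k 0 ∧
      ∀ x ∈ C, x ≠ 0 → d ≤ hammingNorm x := by
  obtain ⟨C, ⟨hk, hd⟩, hr⟩ := h
  refine ⟨C, hk, hr, hk ▸ hasShortening_finrank_zero, fun x hx hx0 => ?_⟩
  simpa using hd x hx 0 C.zero_mem hx0

theorem griesmerBound_le_of_mem_lrcLengths {n k d r : ℕ} (h : n ∈ lrcLengths (ZMod 2) k d r) :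
    griesmerBound k d ≤ n := by
  obtain ⟨C, -, -, hs, hd⟩ := exists_code_of_mem_lrcLengths h
  simpa using hs.griesmerBound_le hd

theorem three_add_griesmerBound_le_of_mem_lrcLengths {n k d : ℕ}
    (h : n ∈ lrcLengths (ZMod 2) (k + 2) d 2) : 3 + griesmerBound k d ≤ n := by
  obtain ⟨C, -, hr, hs, hd⟩ := exists_code_of_mem_lrcLengths h
  simpa using (hs.add_three hr).griesmerBound_le hd

theorem eight_le_of_mem_lrcLengths {n d : ℕ} (h : n ∈ lrcLengths (ZMod 2) 5 d 2) : 8 ≤ n := by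
  obtain ⟨C, -, hr, hs, hd⟩ := exists_code_of_mem_lrcLengths h
  have := (((hs.add_three hr).add_three hr).add_two hr).griesmerBound_le hd
  omega

theorem min_griesmerBound_le_of_mem_lrcLengths {n d : ℕ}
    (h : n ∈ lrcLengths (ZMod 2) 5 d 2) :
    min (5 + griesmerBound 2 d) (7 + griesmerBound 1 d) ≤ n := by
  obtain ⟨C, hk, hr, -, hd⟩ := exists_code_of_mem_lrcLengths h
  rcases hasShortening_two_five_or_one_seven hk hr with h | h
  · exact (min_le_left _ _).trans (h.griesmerBound_le hd)
  · exact (min_le_right _ _).trans (h.griesmerBound_le hd)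

/-! ### Codes from lists of columns -/

/-- The linear functional on `𝔽₂⁵` with coefficient vector the binary expansion of `v`: one column of
a generator matrix. -/
def columnFunctional (v : ℕ) : (Fin 5 → ZMod 2) →ₗ[ZMod 2] ZMod 2 :=
  ∑ j : Fin 5, if v.testBit j then LinearMap.proj j else 0

theorem columnFunctional_apply (v : ℕ) (x : Fin 5 → ZMod 2) :
    columnFunctional v x = ∑ j : Fin 5, if v.testBit j then x j else 0 := by
  rw [columnFunctional, LinearMap.sum_apply]
  refine Finset.sum_congr rfl fun j _ => ?_
  split_ifs <;> rfl

theorem columnFunctional_xor (v w : ℕ) (x : Fin 5 → ZMod 2) :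
    columnFunctional (v ^^^ w) x = columnFunctional v x + columnFunctional w x := by
  have h2 : ∀ a : ZMod 2, 0 = a + a := by decide
  simp only [columnFunctional_apply, ← Finset.sum_add_distrib, Nat.testBit_xor]
  refine Finset.sum_congr rfl fun j _ => ?_
  cases v.testBit j <;> cases w.testBit j <;> simp [← h2]

/-- The parity of the last five binary digits of `v`. -/
def bitParity (v : ℕ) : Bool :=
  v.testBit 0 ^^ v.testBit 1 ^^ v.testBit 2 ^^ v.testBit 3 ^^ v.testBit 4

theorem columnFunctional_testBit_ne_zero_iff (v X : ℕ) :
    columnFunctional v (fun j => if X.testBit j then 1 else 0) ≠ 0 ↔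
      bitParity (v &&& X) = true := by
  have key : ∀ a b c d e : Bool,
      ((if a then 1 else 0) + (if b then 1 else 0) + (if c then 1 else 0) +
        (if d then 1 else 0) + (if e then 1 else 0) : ZMod 2) ≠ 0 ↔
      (a ^^ b ^^ c ^^ d ^^ e) = true := by decide
  simp only [bitParity, Nat.testBit_and, ← key, columnFunctional_apply, Fin.sum_univ_five,
    Bool.and_eq_true, ite_and]
  rfl

theorem exists_testBit_eq (x : Fin 5 → ZMod 2) :
    ∃ X < 32, x = fun j : Fin 5 => if X.testBit j then 1 else 0 := by
  revert x
  decide +kernel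

/-- The code whose generator matrix has the entries of `l` as columns. -/
def columnCode (l : List ℕ) : Submodule (ZMod 2) (Fin l.length → ZMod 2) :=
  LinearMap.range (LinearMap.pi fun i : Fin l.length => columnFunctional (l.get i))

/-- A computable certificate that the binary code with the columns `l` has minimum distance at least
`d` and locality `2`: a column that occurs only once must be the sum of two other columns. -/
def isLRCCertificate (l : List ℕ) (d : ℕ) : Bool :=
  ((List.range 31).all fun X => decide (d ≤ l.countP fun v => bitParity (v &&& (X + 1)))) &&
    l.all fun v => decide (2 ≤ l.count v) ||
      l.any fun a => a != 0 && a != v && l.contains (a ^^^ v)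

theorem card_filter_get {α : Type*} (l : List α) (p : α → Bool) :
    (Finset.univ.filter fun i : Fin l.length => p (l.get i) = true).card = l.countP p := by
  induction l with
  | nil => rfl
  | cons a l ih =>
    rw [List.countP_cons, ← ih, add_comm]
    exact Fin.card_filter_univ_succ' _

theorem hasLocality_columnCode {l : List ℕ}
    (h : ∀ v ∈ l, 2 ≤ l.count v ∨ ∃ a ∈ l, a ≠ 0 ∧ a ≠ v ∧ a ^^^ v ∈ l) :
    HasLocality (columnCode l : Set (Fin l.length → ZMod 2)) 2 := by
  intro i
  rcases h (l.get i) (l.get_mem i) with h | ⟨a, ha, ha0, hav, hb⟩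
  · obtain ⟨j, hj, hji⟩ : ∃ j, j ≠ i ∧ l.get j = l.get i := by
      by_contra! hne
      have : l.count (l.get i) ≤ 1 := by
        rw [List.count, ← card_filter_get]
        refine Finset.card_le_one.mpr fun a ha b hb => ?_
        have := hne a
        have := hne b
        simp at ha hb
        grind
      omega
    refine ⟨{j}, by simpa using hj.symm, by simp, ?_⟩
    rintro _ ⟨x, rfl⟩ _ ⟨y, rfl⟩ hxy
    have := hxy j (Finset.mem_singleton_self j)
    simp only [LinearMap.pi_apply] at this ⊢
    rwa [← hji]
  · obtain ⟨j, rfl⟩ := List.get_of_mem ha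
    obtain ⟨k, hk⟩ := List.get_of_mem hb
    refine ⟨{j, k}, ?_, Finset.card_le_two, ?_⟩
    · simp only [Finset.mem_insert, Finset.mem_singleton, not_or]
      constructor
      · rintro rfl
        exact hav rfl
      · rintro rfl
        exact ha0 (by simpa using hk.symm)
    · have hsum : ∀ x, columnFunctional (l.get i) x =
          columnFunctional (l.get j) x + columnFunctional (l.get k) x := fun x => by
        rw [← columnFunctional_xor, hk, ← Nat.xor_assoc, Nat.xor_self, Nat.zero_xor]
      rintro _ ⟨x, rfl⟩ _ ⟨y, rfl⟩ hxy
      have hj := hxy j (by simp)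
      have hk := hxy k (by simp)
      simp only [LinearMap.pi_apply] at hj hk ⊢
      rw [hsum, hsum, hj, hk]

theorem mem_lrcLengths_of_isLRCCertificate {l : List ℕ} {d : ℕ} (hd : 0 < d)
    (h : isLRCCertificate l d = true) : l.length ∈ lrcLengths (ZMod 2) 5 d 2 := by
  simp only [isLRCCertificate, Bool.and_eq_true, List.all_eq_true, List.mem_range,
    decide_eq_true_eq, Bool.or_eq_true, List.any_eq_true, bne_iff_ne, List.contains_iff_mem] at h
  obtain ⟨hw, hl⟩ := h
  set φ := LinearMap.pi fun i : Fin l.length => columnFunctional (l.get i) with hφ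
  have hweight : ∀ x, x ≠ 0 → d ≤ hammingNorm (φ x) := by
    intro x hx
    obtain ⟨X, hX, rfl⟩ := exists_testBit_eq x
    have hX0 : X ≠ 0 := by
      rintro rfl
      exact hx (by ext; simp)
    have := hw (X - 1) (by omega)
    rw [Nat.sub_add_cancel (by omega), ← card_filter_get] at this
    simp only [← columnFunctional_testBit_ne_zero_iff] at this
    exact this
  have hinj : Function.Injective φ := by
    rw [← LinearMap.ker_eq_bot, LinearMap.ker_eq_bot']
    intro x hx
    by_contra hx0
    have := hweight x hx0
    rw [hx, hammingNorm_zero] at this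
    omega
  refine ⟨columnCode l, ⟨?_, ?_⟩, hasLocality_columnCode fun v hv => ?_⟩
  · rw [columnCode, LinearMap.finrank_range_of_inj hinj, Module.finrank_fin_fun]
  · rintro _ ⟨x, rfl⟩ _ ⟨y, rfl⟩ hxy
    rw [hammingDist_comm, hammingDist_eq_hammingNorm, ← hφ, ← map_neg, ← map_add,
      neg_add_eq_sub]
    exact hweight _ (sub_ne_zero.mpr fun h => hxy (by rw [h]))
  · rcases hl v hv with h | ⟨a, ha, ⟨h0, h1⟩, h2⟩
    · exact Or.inl h
    · exact Or.inr ⟨a, ha, h0, h1, h2⟩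

/-! ### Juxtaposition -/

theorem hammingDist_append {F : Type*} [DecidableEq F] {m n : ℕ} (x x' : Fin m → F)
    (y y' : Fin n → F) :
    hammingDist (Fin.append x y) (Fin.append x' y') = hammingDist x x' + hammingDist y y' := by
  simp only [hammingDist, Finset.card_filter, Fin.sum_univ_add, Fin.append_left, Fin.append_right]

/-- Writing the codewords of two codes of the same dimension next to each other, matched by a linear
isomorphism, adds lengths and distances and keeps the locality. -/
theorem add_mem_lrcLengths {F : Type*} [Field F] [DecidableEq F] {m n k d e r : ℕ}
    (hm : m ∈ lrcLengths F k d r) (hn : n ∈ lrcLengths F k e r) :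
    m + n ∈ lrcLengths F k (d + e) r := by
  obtain ⟨C, ⟨hCk, hCd⟩, hCr⟩ := hm
  obtain ⟨D, ⟨hDk, hDd⟩, hDr⟩ := hn
  let f : C ≃ₗ[F] D := LinearEquiv.ofFinrankEq C D (hCk.trans hDk.symm)
  let φ : C →ₗ[F] (Fin (m + n) → F) :=
    { toFun := fun x => Fin.append x.1 (f x).1
      map_add' := fun x y => by
        ext i
        refine Fin.addCases (fun i => ?_) (fun i => ?_) i <;> simp
      map_smul' := fun a x => by
        ext i
        refine Fin.addCases (fun i => ?_) (fun i => ?_) i <;> simp }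
  have hφ : ∀ x, φ x = Fin.append x.1 (f x).1 := fun _ => rfl
  have hinj : Function.Injective φ := by
    intro x y hxy
    ext i
    simpa [hφ] using congrFun hxy (Fin.castAdd n i)
  refine ⟨LinearMap.range φ, ⟨by rw [LinearMap.finrank_range_of_inj hinj, hCk], ?_⟩, ?_⟩
  · rintro _ ⟨x, rfl⟩ _ ⟨y, rfl⟩ hxy
    have hne : x ≠ y := fun h => hxy (by rw [h])
    rw [hφ, hφ, hammingDist_append]
    exact Nat.add_le_add (hCd _ x.2 _ y.2 fun h => hne (Subtype.ext h))
      (hDd _ (f x).2 _ (f y).2 fun h => hne (f.injective (Subtype.ext h)))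
  · intro i
    refine Fin.addCases (fun i => ?_) (fun i => ?_) i
    · obtain ⟨S, hi, hS, h⟩ := hCr i
      refine ⟨S.map (Fin.castAddEmb n), by simpa using hi, by simpa using hS, ?_⟩
      rintro _ ⟨x, rfl⟩ _ ⟨y, rfl⟩ hxy
      simpa [hφ] using h _ x.2 _ y.2 fun j hj => by
        simpa [hφ] using hxy (Fin.castAdd n j) (by simpa using hj)
    · obtain ⟨S, hi, hS, h⟩ := hDr i
      refine ⟨S.map (Fin.natAddEmb m), by simpa using hi, by simpa using hS, ?_⟩
      rintro _ ⟨x, rfl⟩ _ ⟨y, rfl⟩ hxy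
      simpa [hφ] using h _ (f x).2 _ (f y).2 fun j hj => by
        simpa [hφ] using hxy (Fin.natAdd m j) (by simpa using hj)

/-! ### The optimal codes -/

/-- The points of `PG(4, 2)`: the columns of the simplex code. -/
def points : List ℕ := List.range' 1 31

/-- The points of the plane `⟨1, 2, 4⟩` of `PG(4, 2)`. -/
def plane : List ℕ := List.range' 1 7

/-- The points of the solid `⟨1, 2, 4, 8⟩` of `PG(4, 2)`. -/
def solid : List ℕ := List.range' 1 15

/-- The points of the plane `⟨1, 2, 16⟩` of `PG(4, 2)`, which meets `solid` in a line. -/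
def plane' : List ℕ := [1, 2, 3, 16, 17, 18, 19]

theorem mem_lrcLengths_of_certificate {n d : ℕ} (l : List ℕ) (hd : 0 < d)
    (h : (l.length == n && isLRCCertificate l d) = true) : n ∈ lrcLengths (ZMod 2) 5 d 2 := by
  rw [Bool.and_eq_true, beq_iff_eq] at h
  exact h.1 ▸ mem_lrcLengths_of_isLRCCertificate hd h.2

/-- Adding copies of the simplex code, which has length `31` and constant weight `16`. -/
theorem add_mul_mem_lrcLengths {n d : ℕ} (h : n ∈ lrcLengths (ZMod 2) 5 d 2) (t : ℕ) :
    n + 31 * t ∈ lrcLengths (ZMod 2) 5 (d + 16 * t) 2 := by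
  induction t with
  | zero => exact h
  | succ t ih =>
    have hs : 31 ∈ lrcLengths (ZMod 2) 5 16 2 :=
      mem_lrcLengths_of_certificate points (by norm_num) (by decide +kernel)
    rw [mul_add_one, mul_add_one, ← add_assoc, ← add_assoc]
    exact add_mem_lrcLengths ih hs

/-- If a length meets the Griesmer bound, then so do the lengths obtained by adding copies of the
simplex code. -/
theorem minLRCLength_eq_of_certificate {n d : ℕ} (t : ℕ) (l : List ℕ) (hd : 0 < d)
    (h : (l.length == n && isLRCCertificate l d) = true)
    (hg : n + 31 * t ≤ griesmerBound 5 (d + 16 * t)) :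
    minLRCLength (ZMod 2) 5 (d + 16 * t) 2 = ((n + 31 * t : ℕ) : ℕ∞) :=
  (minLRCLength_eq_coe_iff _ _ _ _ _).mpr
    ⟨add_mul_mem_lrcLengths (mem_lrcLengths_of_certificate l hd h) t,
      fun _ hm => hg.trans (griesmerBound_le_of_mem_lrcLengths hm)⟩

theorem lrcLengths_anti {F : Type*} [Field F] [DecidableEq F] {k r d e : ℕ} (h : d ≤ e) :
    lrcLengths F k e r ⊆ lrcLengths F k d r :=
  fun _ ⟨C, ⟨hk, hd⟩, hr⟩ => ⟨C, ⟨hk, fun x hx y hy hxy => h.trans (hd x hx y hy hxy)⟩, hr⟩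

theorem eight_mem_lrcLengths : 8 ∈ lrcLengths (ZMod 2) 5 2 2 :=
  mem_lrcLengths_of_certificate [1, 2, 3, 4, 8, 12, 16, 16] (by norm_num) (by decide +kernel)

theorem mainTheorem6 :
    (∀ t : ℕ,
      minLRCLength (ZMod 2) 5 (9 + 16 * t) 2 = ((20 + 31 * t : ℕ) : ℕ∞) ∧
      minLRCLength (ZMod 2) 5 (10 + 16 * t) 2 = ((21 + 31 * t : ℕ) : ℕ∞) ∧
      minLRCLength (ZMod 2) 5 (11 + 16 * t) 2 = ((23 + 31 * t : ℕ) : ℕ∞) ∧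
      minLRCLength (ZMod 2) 5 (12 + 16 * t) 2 = ((24 + 31 * t : ℕ) : ℕ∞) ∧
      minLRCLength (ZMod 2) 5 (13 + 16 * t) 2 = ((27 + 31 * t : ℕ) : ℕ∞) ∧
      minLRCLength (ZMod 2) 5 (14 + 16 * t) 2 = ((28 + 31 * t : ℕ) : ℕ∞) ∧
      minLRCLength (ZMod 2) 5 (15 + 16 * t) 2 = ((30 + 31 * t : ℕ) : ℕ∞) ∧
      minLRCLength (ZMod 2) 5 (16 + 16 * t) 2 = ((31 + 31 * t : ℕ) : ℕ∞) ∧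
      minLRCLength (ZMod 2) 5 (17 + 16 * t) 2 = ((36 + 31 * t : ℕ) : ℕ∞) ∧
      minLRCLength (ZMod 2) 5 (18 + 16 * t) 2 = ((37 + 31 * t : ℕ) : ℕ∞) ∧
      minLRCLength (ZMod 2) 5 (19 + 16 * t) 2 = ((39 + 31 * t : ℕ) : ℕ∞) ∧
      minLRCLength (ZMod 2) 5 (20 + 16 * t) 2 = ((40 + 31 * t : ℕ) : ℕ∞) ∧
      minLRCLength (ZMod 2) 5 (21 + 16 * t) 2 = ((43 + 31 * t : ℕ) : ℕ∞) ∧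
      minLRCLength (ZMod 2) 5 (22 + 16 * t) 2 = ((44 + 31 * t : ℕ) : ℕ∞) ∧
      minLRCLength (ZMod 2) 5 (23 + 16 * t) 2 = ((46 + 31 * t : ℕ) : ℕ∞) ∧
      minLRCLength (ZMod 2) 5 (24 + 16 * t) 2 = ((47 + 31 * t : ℕ) : ℕ∞)) ∧
    minLRCLength (ZMod 2) 5 1 2 = 8 ∧
    minLRCLength (ZMod 2) 5 2 2 = 8 ∧
    minLRCLength (ZMod 2) 5 3 2 = 10 ∧
    minLRCLength (ZMod 2) 5 4 2 = 11 ∧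
    minLRCLength (ZMod 2) 5 5 2 = 13 ∧
    minLRCLength (ZMod 2) 5 6 2 = 14 ∧
    minLRCLength (ZMod 2) 5 7 2 = 16 ∧
    minLRCLength (ZMod 2) 5 8 2 = 17 := by
  have small : ∀ {n d : ℕ}, n ∈ lrcLengths (ZMod 2) 5 d 2 →
      (∀ m ∈ lrcLengths (ZMod 2) 5 d 2, n ≤ m) → minLRCLength (ZMod 2) 5 d 2 = (n : ℕ∞) :=
    fun h h' => (minLRCLength_eq_coe_iff _ _ _ _ _).mpr ⟨h, h'⟩
  refine ⟨fun t => ⟨?_, ?_, ?_, ?_, ?_, ?_, ?_, ?_, ?_, ?_, ?_, ?_, ?_, ?_, ?_, ?_⟩,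
    ?_, ?_, ?_, ?_, ?_, ?_, ?_, ?_⟩
  -- Distances `9, …, 16`: points removed from `PG(4, 2)`. A codeword loses weight `1`, `2`, `4` or
  -- `8` at most when a point, a line, a plane or a solid is removed.
  · exact minLRCLength_eq_of_certificate t (points.diff (plane ++ [8, 16, 24, 9]))
      (by norm_num) (by decide +kernel) (by simp only [griesmerBound]; omega)
  · exact minLRCLength_eq_of_certificate t (points.diff (plane ++ [8, 16, 24]))
      (by norm_num) (by decide +kernel) (by simp only [griesmerBound]; omega)
  · exact minLRCLength_eq_of_certificate t (points.diff (plane ++ [8]))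
      (by norm_num) (by decide +kernel) (by simp only [griesmerBound]; omega)
  · exact minLRCLength_eq_of_certificate t (points.diff plane)
      (by norm_num) (by decide +kernel) (by simp only [griesmerBound]; omega)
  · exact minLRCLength_eq_of_certificate t (points.diff [1, 2, 3, 4])
      (by norm_num) (by decide +kernel) (by simp only [griesmerBound]; omega)
  · exact minLRCLength_eq_of_certificate t (points.diff [1, 2, 3])
      (by norm_num) (by decide +kernel) (by simp only [griesmerBound]; omega)
  · exact minLRCLength_eq_of_certificate t (points.diff [1])
      (by norm_num) (by decide +kernel) (by simp only [griesmerBound]; omega)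
  · exact minLRCLength_eq_of_certificate t points
      (by norm_num) (by decide +kernel) (by simp only [griesmerBound]; omega)
  -- Distances `17, …, 24`: points removed from two copies of `PG(4, 2)`.
  · exact minLRCLength_eq_of_certificate t
      ((points ++ points).diff (solid ++ plane' ++ [4, 24, 28, 5]))
      (by norm_num) (by decide +kernel) (by simp only [griesmerBound]; omega)
  · exact minLRCLength_eq_of_certificate t
      ((points ++ points).diff (solid ++ plane' ++ [4, 24, 28]))
      (by norm_num) (by decide +kernel) (by simp only [griesmerBound]; omega)
  · exact minLRCLength_eq_of_certificate t ((points ++ points).diff (solid ++ plane' ++ [4]))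
      (by norm_num) (by decide +kernel) (by simp only [griesmerBound]; omega)
  · exact minLRCLength_eq_of_certificate t ((points ++ points).diff (solid ++ plane'))
      (by norm_num) (by decide +kernel) (by simp only [griesmerBound]; omega)
  · exact minLRCLength_eq_of_certificate t ((points ++ points).diff (solid ++ [1, 16, 17, 2]))
      (by norm_num) (by decide +kernel) (by simp only [griesmerBound]; omega)
  · exact minLRCLength_eq_of_certificate t ((points ++ points).diff (solid ++ [1, 16, 17]))
      (by norm_num) (by decide +kernel) (by simp only [griesmerBound]; omega)
  · exact minLRCLength_eq_of_certificate t ((points ++ points).diff (solid ++ [1]))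
      (by norm_num) (by decide +kernel) (by simp only [griesmerBound]; omega)
  · exact minLRCLength_eq_of_certificate t ((points ++ points).diff solid)
      (by norm_num) (by decide +kernel) (by simp only [griesmerBound]; omega)
  · exact small (lrcLengths_anti one_le_two eight_mem_lrcLengths)
      fun m hm => eight_le_of_mem_lrcLengths hm
  · exact small eight_mem_lrcLengths fun m hm => eight_le_of_mem_lrcLengths hm
  -- Distances `3, …, 7`: these lists of columns come from a computer search.
  · exact small (mem_lrcLengths_of_certificate [3, 6, 8, 11, 17, 19, 20, 21, 23, 27]
      (by norm_num) (by decide +kernel))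
      fun m hm => min_griesmerBound_le_of_mem_lrcLengths hm
  · exact small (mem_lrcLengths_of_certificate [1, 5, 13, 14, 17, 19, 20, 22, 23, 29, 30]
      (by norm_num) (by decide +kernel))
      fun m hm => min_griesmerBound_le_of_mem_lrcLengths hm
  · exact small (mem_lrcLengths_of_certificate [1, 3, 7, 8, 14, 17, 19, 20, 21, 22, 24, 25, 28]
      (by norm_num) (by decide +kernel))
      fun m hm => three_add_griesmerBound_le_of_mem_lrcLengths hm
  · exact small (mem_lrcLengths_of_certificate [2, 4, 7, 9, 10, 12, 17, 18, 19, 20, 23, 26, 27, 28]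
      (by norm_num) (by decide +kernel))
      fun m hm => three_add_griesmerBound_le_of_mem_lrcLengths hm
  · exact small (mem_lrcLengths_of_certificate
      [1, 2, 3, 4, 5, 8, 9, 14, 14, 16, 18, 20, 23, 24, 29, 31]
      (by norm_num) (by decide +kernel))
      fun m hm => three_add_griesmerBound_le_of_mem_lrcLengths hm
  -- Distance `8`: the affine space of the points `16, …, 31` and one point at infinity.
  · exact small (mem_lrcLengths_of_certificate (1 :: List.range' 16 16)
      (by norm_num) (by decide +kernel))
      fun m hm => three_add_griesmerBound_le_of_mem_lrcLengths hm
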